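/- A semiring $S=(S,+,\cdot,0,1)$ is an additive commutative monoid $(S,+,0)$ together with a monoid $(S,\cdot,1)$ such that multiplication distributes over addition on both sides and $0s=0=s0$ for all $s\in S$. A left (right) $S$-semimodule is a commutative monoid $(M,+,0)$ with a scalar multiplication by $S$ satisfying the usual unital module axioms (including $0m=0=s0$). It is cyclic if it is a homomorphic image of $S$ regarded as a left (right) semimodule over itself, and it is injective if for every injective homomorphism $\mu:A\to B$ of left (right) $S$-semimodules and every homomorphism $f:A\to M$ there is a homomorphism $g:B\to M$ with $g\mu=f$. A semiring $S$ is a left (right) CI-semiring if every cyclic left (right) $S$-semimodule is injective. For an associative unital ring $R=(R,+,\cdot,e,1)$ with zero $e$ and unit $1$, let $\mathrm{Ext}(R)=R\cup\{0,\infty\}$, where $0\neq\infty$ are two new elements not in $R$, with the operations of $R$ extended by $$0+t=t=t+0,\qquad 0\cdot t=0=t\cdot 0\qquad\text{for all } t\in \mathrm{Ext}(R),$$ $$x+\infty=\infty=\infty+x,\qquad x\cdot\infty=\infty=\infty\cdot x\qquad\text{for all } x\in R\cup\{\infty\}.$$ Then $\mathrm{Ext}(R)$ is a semiring with zero $0$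 and unit $1$. **Theorem.** Let $R$ be an associative unital ring. Then $\mathrm{Ext}(R)$ is a left CI-semiring if and only if $R$ is a semisimple ring; and $\mathrm{Ext}(R)$ is a right CI-semiring if and only if $R$ is a semisimple ring. -/

import Mathlib

universe u

/-- The underlying set `Ext(R) = R ∪ {0, ∞}`: a ring `R` with two new elements adjoined.
The zero `e` of `R` is the element `ofRing 0`, distinct from the new element `zero`. -/
inductive RingExt (R : Type u) : Type u
  | zero : RingExt R
  | ofRing (r : R) : RingExt R
  | infty : RingExt R

namespace RingExt

variable {R : Type u}

/-- Addition of `Ext(R)`: the new zero is neutral, `∞` absorbs everything, and elements of `R`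
are added in `R`. -/
protected def add [Add R] : RingExt R → RingExt R → RingExt R
  | zero, y => y
  | x, zero => x
  | ofRing r, ofRing s => ofRing (r + s)
  | infty, _ => infty
  | _, infty => infty

/-- Multiplication of `Ext(R)`: the new zero absorbs everything, `∞` absorbs every element
other than the new zero, and elements of `R` are multiplied in `R`. -/
protected def mul [Mul R] : RingExt R → RingExt R → RingExt R
  | zero, _ => zero
  | _, zero => zero
  | ofRing r, ofRing s => ofRing (r * s)
  | infty, _ => infty
  | _, infty => infty

instance : Zero (RingExt R) := ⟨zero⟩

instance [One R] : One (RingExt R) := ⟨ofRing 1⟩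

instance [Add R] : Add (RingExt R) := ⟨RingExt.add⟩

instance [Mul R] : Mul (RingExt R) := ⟨RingExt.mul⟩

/-- The semiring `Ext(R)`, with zero the new element `zero` and with unit the unit of `R`. -/
instance [Ring R] : Semiring (RingExt R) where
  nsmul := nsmulRec
  add_assoc a b c := by
    change RingExt.add (RingExt.add a b) c = RingExt.add a (RingExt.add b c)
    cases a <;> cases b <;> cases c <;> simp [RingExt.add, add_assoc]
  zero_add a := by
    change RingExt.add zero a = a
    cases a <;> rfl
  add_zero a := by
    change RingExt.add a zero = a
    cases a <;> rfl
  add_comm a b := by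
    change RingExt.add a b = RingExt.add b a
    cases a <;> cases b <;> simp [RingExt.add, add_comm]
  mul_assoc a b c := by
    change RingExt.mul (RingExt.mul a b) c = RingExt.mul a (RingExt.mul b c)
    cases a <;> cases b <;> cases c <;> simp [RingExt.mul, mul_assoc]
  one_mul a := by
    change RingExt.mul (ofRing 1) a = a
    cases a <;> simp [RingExt.mul]
  mul_one a := by
    change RingExt.mul a (ofRing 1) = a
    cases a <;> simp [RingExt.mul]
  zero_mul a := by
    change RingExt.mul zero a = zero
    cases a <;> rfl
  mul_zero a := by
    change RingExt.mul a zero = zero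
    cases a <;> rfl
  left_distrib a b c := by
    change RingExt.mul a (RingExt.add b c) = RingExt.add (RingExt.mul a b) (RingExt.mul a c)
    cases a <;> cases b <;> cases c <;> simp [RingExt.mul, RingExt.add, mul_add]
  right_distrib a b c := by
    change RingExt.mul (RingExt.add a b) c = RingExt.add (RingExt.mul a c) (RingExt.mul b c)
    cases a <;> cases b <;> cases c <;> simp [RingExt.mul, RingExt.add, add_mul]

end RingExt

/-- A left `S`-semimodule `M` over a semiring `S` (Mathlib's `Module S M`, with `M` only an
additive commutative monoid) is injective if every homomorphism `f : A → M` extends along every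
injective homomorphism `μ : A → B` of left `S`-semimodules. -/
def IsInjectiveSemimodule (S : Type u) [Semiring S] (M : Type u) [AddCommMonoid M] [Module S M] :
    Prop :=
  ∀ (A B : Type u) [AddCommMonoid A] [AddCommMonoid B] [Module S A] [Module S B]
    (μ : A →ₗ[S] B), Function.Injective μ → ∀ f : A →ₗ[S] M, ∃ g : B →ₗ[S] M, g.comp μ = f

/-- `S` is a left CI-semiring: every cyclic left `S`-semimodule, that is, every homomorphic image
of the left regular semimodule, is injective. -/
def IsLeftCISemiring (S : Type u) [Semiring S] : Prop :=
  ∀ (M : Type u) [AddCommMonoid M] [Module S M],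
    (∃ p : S →ₗ[S] M, Function.Surjective p) → IsInjectiveSemimodule S M

/-- `S` is a right CI-semiring: every cyclic right `S`-semimodule, that is, every homomorphic
image of the right regular semimodule, is injective. Right `S`-semimodules are modules over
`Sᵐᵒᵖ`, with `MulOpposite.op s • m` playing the role of `m s`. -/
def IsRightCISemiring (S : Type u) [Semiring S] : Prop :=
  ∀ (M : Type u) [AddCommMonoid M] [Module Sᵐᵒᵖ M],
    (∃ p : S →ₗ[Sᵐᵒᵖ] M, Function.Surjective p) → IsInjectiveSemimodule Sᵐᵒᵖ M

/-!
`Ext(R)`-semimodules reduce to `R`-modules in the following way. In an `Ext(R)`-semimodule `B`, the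
zero `e` of `R` acts by `x + e x = x` and `e x = x - x`, so `e B` is a join-semilattice (with
`e x ≤ e y` meaning `e x + e y = e y`) and the fibres of `x ↦ e x` are `R`-modules; `∞` acts as a
closure operator on the semilattice, and the fibre over `∞ x` is a single element.

Consequently a cyclic semimodule is either `N ∪ {0, ∞}` for a cyclic `R`-module `N`, or, when `e`
and `∞` act equally on the generator, a retract of `{e, 0, ∞}`, which is the case `N = 0`. Both
directions then follow from a comparison of injectivity of `N` and of `N ∪ {0, ∞}`.

If `N` is injective, so is `N ∪ {0, ∞}` (`ModuleExt.isInjectiveSemimodule`). Given `μ : A → B` and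
`f : A → N ∪ {0, ∞}`, let `F ⊆ B` be the lower set generated by the `e μ(a)` with `f a ≠ ∞`. The
colimit of the fibres over `F` is the cancellative quotient of `F`, an `R`-module `L` into which the
corresponding colimit for `A` embeds; `f` induces a map from the latter to `N`, which extends to
`h : L → N`. The extension of `f` is `0` where `∞ b ∈ F`, then `h` on the rest of `F`, and `∞`
outside `F`. Over a semisimple ring every module is injective, which gives one implication.

Conversely, applying `N ↦ N ∪ {0, ∞}` to an extension problem of `R`-modules shows that if
`Ext(R)` is a CI-semiring, then every cyclic `R`-module is injective
(`baer_of_allCyclicInjective`). By Osofsky's theorem (`isSemisimpleRing_of_forall_baer`) `R` is then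
semisimple. For the latter: such a ring is von Neumann regular, so unless it is semisimple it
contains an infinite orthogonal family of nonzero idempotents, indexed here as `e (j, k)`. Let `U`
be the left ideal of the `x` that annihilate almost all rows of the family and `V` that of the `x`
that annihilate almost all members of each row. Injectivity of `R ⧸ (U ⊓ V)` gives `y` acting on it
from the right as the identity on `U` and as zero on `V`. Each row lies in `U` and hence contains
some `e (j, s j)` fixed by `y`, in the sense that `e y e = e`; but the graph of `s` lies in `V`, so
that `e y e = 0` for almost all of its members.

The right-hand version is the left-hand one for the opposite ring.
-/

/-! ### Osofsky's theorem -/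

section Osofsky

variable {R : Type u} [Ring R]

/-- The map `U ⊔ V → R ⧸ J` that is the projection on `U` and zero on `V` is well defined when
`U ⊓ V ≤ J`; if `R ⧸ J` is injective, it is right multiplication by some element of `R`. -/
theorem exists_mul_sub_mem_of_baer {J U V : Submodule R R} (hJ : Module.Baer R (R ⧸ J))
    (h : U ⊓ V ≤ J) : ∃ y : R, (∀ x ∈ U, x * y - x ∈ J) ∧ ∀ x ∈ V, x * y ∈ J := by
  let f : R →ₗ.[R] (R ⧸ J) := ⟨U, J.mkQ ∘ₗ U.subtype⟩
  let g : R →ₗ.[R] (R ⧸ J) := ⟨V, 0⟩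
  have H : ∀ (x : f.domain) (y : g.domain), (x : R) = y → f x = g y := by
    rintro ⟨x, hx⟩ ⟨y, hy⟩ (rfl : x = y)
    exact (Submodule.Quotient.mk_eq_zero J).2 (h ⟨hx, hy⟩)
  obtain ⟨q, hq⟩ := hJ _ (f.sup g H).toFun
  obtain ⟨y, hy⟩ := J.mkQ_surjective (q 1)
  have key : ∀ x, J.mkQ (x * y) = q x := fun x => by
    rw [← smul_eq_mul, map_smul, hy, ← map_smul, smul_eq_mul, mul_one]
  refine ⟨y, fun x hx => ?_, fun x hx => ?_⟩
  · have := (f.left_le_sup g H).2 (x := ⟨x, hx⟩) (y := ⟨x, Submodule.mem_sup_left hx⟩) rfl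
    rw [← Submodule.Quotient.eq J]
    exact (key x).trans ((hq x (Submodule.mem_sup_left hx)).trans this.symm)
  · have := (f.right_le_sup g H).2 (x := ⟨x, hx⟩) (y := ⟨x, Submodule.mem_sup_right hx⟩) rfl
    rw [← Submodule.Quotient.mk_eq_zero J]
    exact (key x).trans ((hq x (Submodule.mem_sup_right hx)).trans this.symm)

/-- A ring whose cyclic left modules are all injective is von Neumann regular: for `z : R` the
inverse of the isomorphism `R ⧸ ann z ≃ R z` extends to `R`, and any lift `w` of the image of `1`
satisfies `z w - 1 ∈ ann z`. -/
theorem exists_mul_mul_eq_self_of_baer (H : ∀ J : Submodule R R, Module.Baer R (R ⧸ J)) (z : R) :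
    ∃ w, z * w * z = z := by
  let t := LinearMap.toSpanSingleton R R z
  obtain ⟨q, hq⟩ := H (LinearMap.ker t) (LinearMap.range t) t.quotKerEquivRange.symm.toLinearMap
  obtain ⟨w, hw⟩ := (LinearMap.ker t).mkQ_surjective (q 1)
  refine ⟨w, ?_⟩
  have hz : z ∈ LinearMap.range t := ⟨1, by simp [t]⟩
  have h1 : (LinearMap.ker t).mkQ (z * w) = (LinearMap.ker t).mkQ 1 := by
    rw [← smul_eq_mul, map_smul, hw, ← map_smul, smul_eq_mul, mul_one, hq z hz]
    change t.quotKerEquivRange.symm _ = _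
    rw [LinearEquiv.symm_apply_eq]
    exact Subtype.ext (by simp [t])
  have h2 := (Submodule.Quotient.eq _).1 h1
  simpa [t, sub_mul, sub_eq_zero] using h2

/-- A maximal submodule `T ≥ U` disjoint from `L` makes `L ⊔ T` essential. -/
theorem exists_disjoint_sup_essential {M : Type*} [AddCommGroup M] [Module R M]
    {L U : Submodule R M} (h : Disjoint L U) :
    ∃ T, U ≤ T ∧ Disjoint L T ∧ ∀ W, Disjoint (L ⊔ T) W → W = ⊥ := by
  obtain ⟨T, hUT, hT⟩ := zorn_le_nonempty₀ {T : Submodule R M | Disjoint L T}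
    (fun c hc hchain y hy => ⟨sSup c, (hchain.directedOn.disjoint_sSup_right).2 fun _ hb => hc hb,
      fun z hz => le_sSup hz⟩) U h
  refine ⟨T, hUT, hT.1, fun W hW => ?_⟩
  have h1 : T ⊔ W ≤ T :=
    hT.2 (Disjoint.disjoint_sup_right_of_disjoint_sup_left hT.1 hW) le_sup_left
  exact disjoint_self.1 (hW.mono_left ((le_sup_right.trans h1).trans le_sup_right))

/-- A von Neumann regular ring is nonsingular: an essential left ideal has no nonzero right
annihilator. -/
theorem eq_zero_of_essential_mul_eq_zero (hreg : ∀ z : R, ∃ w, z * w * z = z) {E : Submodule R R}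
    (hE : ∀ W, Disjoint E W → W = ⊥) {z : R} (hz : ∀ x ∈ E, x * z = 0) : z = 0 := by
  obtain ⟨w, hw⟩ := hreg z
  have h : Submodule.span R {z * w} = ⊥ := hE _ <| by
    rw [Submodule.disjoint_def]
    intro x hx hxw
    obtain ⟨a, rfl⟩ := Submodule.mem_span_singleton.1 hxw
    have h1 := hz _ hx
    rw [smul_eq_mul, mul_assoc, hw] at h1
    rw [smul_eq_mul, ← mul_assoc, h1, zero_mul]
  rw [Submodule.span_singleton_eq_bot] at h
  rw [← hw, h, zero_mul]

/-- Any subset `A` of an orthogonal family of idempotents `e` is cut out by one element `h`, which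
acts as the identity from the right on the members in `A` and annihilates the others from the
left. The left ideal generated by `A` is disjoint from the one generated by the complement of `A`;
`h` is the identity on the former and zero on a maximal left ideal disjoint from it and containing
the latter. Then `h * e i`, for `i ∉ A`, is annihilated by an essential left ideal. -/
theorem exists_mul_eq_indicator (H : ∀ J : Submodule R R, Module.Baer R (R ⧸ J)) {ι : Type*}
    {e : ι → R} (hidem : ∀ i, e i * e i = e i) (horth : ∀ i j, i ≠ j → e i * e j = 0)
    (A : Set ι) : ∃ h, (∀ i ∈ A, e i * h = e i) ∧ ∀ i ∉ A, h * e i = 0 := by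
  have hann : ∀ (B : Set ι), ∀ x ∈ Submodule.span R (e '' B), ∀ i ∉ B, x * e i = 0 := by
    intro B x hx i hi
    induction hx using Submodule.span_induction with
    | mem x hx =>
      obtain ⟨j, hj, rfl⟩ := hx
      exact horth j i fun h => hi (h ▸ hj)
    | zero => exact zero_mul _
    | add x y _ _ hx hy => rw [add_mul, hx, hy, add_zero]
    | smul a x _ hx => rw [smul_eq_mul, mul_assoc, hx, mul_zero]
  have hdisj : Disjoint (Submodule.span R (e '' A)) (Submodule.span R (e '' Aᶜ)) := by
    rw [Submodule.disjoint_def]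
    intro x hx hx'
    have h0 : ∀ i, x * e i = 0 := fun i => by
      by_cases hi : i ∈ A
      · exact hann _ x hx' i (by simpa using hi)
      · exact hann _ x hx i hi
    obtain ⟨c, rfl⟩ := Finsupp.mem_span_range_iff_exists_finsupp.1
      (Submodule.span_mono (Set.image_subset_range e A) hx)
    refine Finset.sum_eq_zero fun i hi => ?_
    have h1 := h0 i
    rw [Finsupp.sum, Finset.sum_mul, Finset.sum_eq_single_of_mem i hi] at h1
    · rwa [smul_eq_mul, mul_assoc, hidem] at h1
    · intro j _ hji
      rw [smul_eq_mul, mul_assoc, horth j i hji, mul_zero]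
  obtain ⟨T, hUT, hT, hess⟩ := exists_disjoint_sup_essential hdisj
  obtain ⟨h, h1, h2⟩ := exists_mul_sub_mem_of_baer (H ⊥) (disjoint_iff_inf_le.1 hT)
  refine ⟨h, fun i hi => ?_, fun i hi => ?_⟩
  · simpa [sub_eq_zero] using h1 _ (Submodule.subset_span ⟨i, hi, rfl⟩)
  · refine eq_zero_of_essential_mul_eq_zero (exists_mul_mul_eq_self_of_baer H) hess fun x hx => ?_
    obtain ⟨y, hy, t, ht, rfl⟩ := Submodule.mem_sup.1 hx
    have hy' : y * h = y := by simpa [sub_eq_zero] using h1 y hy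
    have ht' : t * h = 0 := by simpa using h2 t ht
    rw [add_mul, ← mul_assoc, ← mul_assoc, hy', ht', zero_mul, add_zero, hann A y hy i hi]

/-- In a regular ring, if `R b` is not semisimple for an idempotent `b`, then `b` is a sum of two
nonzero orthogonal idempotents, and one of them again generates a left ideal that is not
semisimple. -/
theorem exists_smaller_idempotent (hreg : ∀ z : R, ∃ w, z * w * z = z) {b : R}
    (hb : b * b = b) (hbad : ¬ IsSemisimpleModule R (Submodule.span R {b})) :
    ∃ c, c * c = c ∧ ¬ IsSemisimpleModule R (Submodule.span R {c}) ∧ b * c = c ∧ c * b = c ∧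
      c ≠ b := by
  -- Otherwise `R b` is zero or simple.
  obtain ⟨a, hab, ha0, hba⟩ :
      ∃ a ∈ Submodule.span R {b}, a ≠ 0 ∧ b ∉ Submodule.span R {a} := by
    by_contra! hcon
    apply hbad
    by_cases hb0 : b = 0
    · rw [hb0, Submodule.span_zero_singleton]
      exact { exists_isCompl := fun p => ⟨p, disjoint_self.2 (Subsingleton.elim _ _),
        codisjoint_self.2 (Subsingleton.elim _ _)⟩ }
    · have : IsSimpleModule R (Submodule.span R {b}) := by
        rw [isSimpleModule_iff_isAtom]
        refine ⟨by simpa using hb0, fun P hP => ?_⟩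
        by_contra hPbot
        obtain ⟨a, haP, ha0⟩ := Submodule.exists_mem_ne_zero_of_ne_bot hPbot
        refine hP.not_ge ((Submodule.span_singleton_le_iff_mem _ _).2 ?_)
        exact (Submodule.span_singleton_le_iff_mem _ _).2 haP (hcon a (hP.le haP) ha0)
      infer_instance
  obtain ⟨s, rfl⟩ := Submodule.mem_span_singleton.1 hab
  set a := s • b with ha
  have hab' : a * b = a := by rw [ha, smul_eq_mul, mul_assoc, hb]
  obtain ⟨w, hw⟩ := hreg a
  -- `g` is an idempotent below `b` with `R g = R a`, a nonzero proper part of `R b`.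
  set g := b * w * a with hg
  have hag : a * g = a := by rw [hg, ← mul_assoc, ← mul_assoc, hab', hw]
  have hbg : b * g = g := by rw [hg, ← mul_assoc, ← mul_assoc, hb]
  have hgb : g * b = g := by rw [hg, mul_assoc, hab']
  have hgg : g * g = g := by
    conv_lhs => rw [hg, mul_assoc, hag]
  have hgne : g ≠ b := fun h => hba (Submodule.mem_span_singleton.2 ⟨b * w, h⟩)
  have hg0 : g ≠ 0 := fun h => ha0 (by rw [← hag, h, mul_zero])
  by_cases hs : IsSemisimpleModule R (Submodule.span R {g})
  -- If `R g` is semisimple then `R (b - g)` is not, since `R b` is the sum of both.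
  · refine ⟨b - g, ?_, fun hs' => hbad ?_, ?_, ?_, by simpa using hg0⟩
    · simp [mul_sub, sub_mul, hb, hbg, hgb, hgg]
    · have := IsSemisimpleModule.sup hs hs'
      have heq : Submodule.span R {g} ⊔ Submodule.span R {b - g} = Submodule.span R {b} := by
        apply le_antisymm
        · refine sup_le ?_ ?_ <;> rw [Submodule.span_singleton_le_iff_mem]
          · exact Submodule.mem_span_singleton.2 ⟨g, hgb⟩
          · exact Submodule.mem_span_singleton.2 ⟨b - g, by simp [sub_mul, hb, hgb]⟩
        · rw [Submodule.span_singleton_le_iff_mem]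
          have := Submodule.add_mem_sup (Submodule.mem_span_singleton_self (R := R) g)
            (Submodule.mem_span_singleton_self (R := R) (b - g))
          rwa [add_sub_cancel] at this
      rwa [heq] at this
    · simp [mul_sub, hb, hbg]
    · simp [sub_mul, hb, hgb]
  · exact ⟨g, hgg, hs, hbg, hgb, hgne⟩

theorem exists_orthogonal_idempotents (hreg : ∀ z : R, ∃ w, z * w * z = z)
    (hR : ¬ IsSemisimpleRing R) :
    ∃ e : ℕ → R, (∀ n, e n ≠ 0) ∧ (∀ n, e n * e n = e n) ∧ ∀ i j, i ≠ j → e i * e j = 0 := by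
  let Bad := {b : R // b * b = b ∧ ¬ IsSemisimpleModule R (Submodule.span R {b})}
  have hstep : ∀ b : Bad, ∃ c : Bad, b.1 * c.1 = c.1 ∧ c.1 * b.1 = c.1 ∧ c.1 ≠ b.1 := by
    rintro ⟨b, hb, hbad⟩
    obtain ⟨c, h1, h2, h3⟩ := exists_smaller_idempotent hreg hb hbad
    exact ⟨⟨c, h1, h2⟩, h3⟩
  choose next hl hr hne using hstep
  have hone : ¬ IsSemisimpleModule R (Submodule.span R {(1 : R)}) := fun h => hR <| by
    have htop : Submodule.span R {(1 : R)} = ⊤ := Ideal.span_singleton_one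
    rw [htop] at h
    exact (Submodule.topEquiv (R := R) (M := R)).isSemisimpleModule_iff.1 h
  let b : ℕ → Bad := fun n => Nat.rec ⟨1, mul_one 1, hone⟩ (fun _ => next) n
  have hs : ∀ n, b (n + 1) = next (b n) := fun n => rfl
  have hle : ∀ i k, (b i).1 * (b (i + k)).1 = (b (i + k)).1 ∧
      (b (i + k)).1 * (b i).1 = (b (i + k)).1 := by
    intro i k
    induction k with
    | zero => exact ⟨(b i).2.1, (b i).2.1⟩
    | succ k ih =>
      rw [← add_assoc, hs]
      constructor
      · rw [← hl (b (i + k)), ← mul_assoc, ih.1]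
      · rw [← hr (b (i + k)), mul_assoc, ih.2]
  have hle' : ∀ i j, i ≤ j → (b i).1 * (b j).1 = (b j).1 ∧ (b j).1 * (b i).1 = (b j).1 := by
    intro i j hij
    obtain ⟨k, rfl⟩ := Nat.exists_eq_add_of_le hij
    exact hle i k
  have hlt : ∀ i j, i < j →
      ((b i).1 - (b (i + 1)).1) * ((b j).1 - (b (j + 1)).1) = 0 ∧
      ((b j).1 - (b (j + 1)).1) * ((b i).1 - (b (i + 1)).1) = 0 := by
    intro i j hij
    have h1 := hle' i j hij.le
    have h2 := hle' i (j + 1) (by omega)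
    have h3 := hle' (i + 1) j (by omega)
    have h4 := hle' (i + 1) (j + 1) (by omega)
    constructor
    · simp [mul_sub, sub_mul, h1.1, h2.1, h3.1, h4.1]
    · simp [mul_sub, sub_mul, h1.2, h2.2, h3.2, h4.2]
  -- The differences of a strictly descending chain of idempotents are orthogonal.
  refine ⟨fun n => (b n).1 - (b (n + 1)).1, fun n => ?_, fun n => ?_, fun i j hij => ?_⟩
  · exact sub_ne_zero.2 (hne (b n)).symm
  · have h1 := hle' n (n + 1) (by omega)
    simp [mul_sub, sub_mul, h1.1, h1.2, (b n).2.1, (b (n + 1)).2.1]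
  · rcases lt_or_gt_of_ne hij with h | h
    · exact (hlt i j h).1
    · exact (hlt j i h).2

open Filter in
/-- **Osofsky's theorem**: a ring whose cyclic left modules are all injective is semisimple. -/
theorem isSemisimpleRing_of_forall_baer (H : ∀ J : Submodule R R, Module.Baer R (R ⧸ J)) :
    IsSemisimpleRing R := by
  by_contra hR
  obtain ⟨e₀, hne, hidem, horth⟩ :=
    exists_orthogonal_idempotents (exists_mul_mul_eq_self_of_baer H) hR
  let e : ℕ × ℕ → R := fun p => e₀ (Nat.pairEquiv p)
  have hidem' : ∀ p, e p * e p = e p := fun p => hidem _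
  have horth' : ∀ p q, p ≠ q → e p * e q = 0 := fun p q h =>
    horth _ _ (Nat.pairEquiv.injective.ne h)
  let U : Submodule R R :=
    { carrier := {x | ∀ᶠ j in atTop, ∀ k, x * e (j, k) = 0}
      zero_mem' := Eventually.of_forall fun j k => zero_mul _
      add_mem' := fun {x y} hx hy => by
        filter_upwards [hx, hy] with j h1 h2 k
        rw [add_mul, h1, h2, add_zero]
      smul_mem' := fun r x hx => by
        filter_upwards [hx] with j h1 k
        rw [smul_eq_mul, mul_assoc, h1, mul_zero] }
  let V : Submodule R R :=
    { carrier := {x | ∀ j, ∀ᶠ k in atTop, x * e (j, k) = 0}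
      zero_mem' := fun j => Eventually.of_forall fun k => zero_mul _
      add_mem' := fun {x y} hx hy j => by
        filter_upwards [hx j, hy j] with k h1 h2
        rw [add_mul, h1, h2, add_zero]
      smul_mem' := fun r x hx j => by
        filter_upwards [hx j] with k h1
        rw [smul_eq_mul, mul_assoc, h1, mul_zero] }
  obtain ⟨y, hyU, hyV⟩ := exists_mul_sub_mem_of_baer (H (U ⊓ V)) le_rfl
  -- The element cutting out row `j` lies in `U`, so `y` fixes it modulo `V`.
  have hrow : ∀ j, ∃ k, e (j, k) * y * e (j, k) = e (j, k) := by
    intro j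
    obtain ⟨h, h1, h2⟩ := exists_mul_eq_indicator H hidem' horth' {p | p.1 = j}
    have hU : h ∈ U := by
      filter_upwards [eventually_gt_atTop j] with i hi k
      exact h2 _ (by simpa using hi.ne')
    obtain ⟨k, hk⟩ := ((hyU h hU).2 j).exists
    refine ⟨k, ?_⟩
    rw [sub_mul, sub_eq_zero] at hk
    have h3 := h1 (j, k) rfl
    calc e (j, k) * y * e (j, k) = e (j, k) * (h * y * e (j, k)) := by
          simp only [← mul_assoc, h3]
      _ = e (j, k) := by rw [hk, ← mul_assoc, h3, hidem']
  choose s hs using hrow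
  -- The element cutting out the graph of `s` lies in `V`, so `y` annihilates it modulo `U`.
  obtain ⟨h, h1, h2⟩ := exists_mul_eq_indicator H hidem' horth' {p | p.2 = s p.1}
  have hV : h ∈ V := fun j => by
    filter_upwards [eventually_gt_atTop (s j)] with k hk
    exact h2 _ (by simpa using hk.ne')
  obtain ⟨j, hj⟩ := (hyV h hV).1.exists
  have h3 := h1 (j, s j) rfl
  apply hne (Nat.pairEquiv (j, s j))
  change e (j, s j) = 0
  rw [← hs j, ← h3, mul_assoc (e (j, s j)) h y, mul_assoc, h3, hj (s j), mul_zero]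

end Osofsky

/-! ### The semimodule `N ∪ {0, ∞}` of an `R`-module `N` -/

/-- The set `N ∪ {0, ∞}`: a module `N` with two new elements adjoined, a neutral `zero` and an
absorbing `infty`. For an `R`-module `N` it is a semimodule over `Ext(R)`. It is a type of its own,
rather than `RingExt N`, so that it carries no second additive structure when `N` is a ring. -/
inductive ModuleExt (N : Type u) : Type u
  | zero : ModuleExt N
  | of (n : N) : ModuleExt N
  | infty : ModuleExt N

namespace ModuleExt

section Algebra

variable {R N N' : Type u}

instance : Zero (ModuleExt N) := ⟨zero⟩

theorem zero_eq : (zero : ModuleExt N) = 0 := rfl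
@[simp] theorem of_ne_zero (n : N) : of n ≠ 0 := nofun
@[simp] theorem infty_ne_zero : (infty : ModuleExt N) ≠ 0 := nofun

variable [Ring R] [AddCommGroup N] [Module R N] [AddCommGroup N'] [Module R N']

/-- Addition of `N ∪ {0, ∞}`. -/
protected def add : ModuleExt N → ModuleExt N → ModuleExt N
  | zero, y => y
  | x, zero => x
  | of m, of n => of (m + n)
  | infty, _ => infty
  | _, infty => infty

/-- The action of `Ext(R)` on `N ∪ {0, ∞}`. -/
protected def smul : RingExt R → ModuleExt N → ModuleExt N
  | .zero, _ => zero
  | _, zero => zero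
  | .ofRing r, of n => of (r • n)
  | .infty, _ => infty
  | _, infty => infty

instance : Add (ModuleExt N) := ⟨ModuleExt.add⟩

instance : AddCommMonoid (ModuleExt N) where
  nsmul := nsmulRec
  add_assoc a b c := by
    change ModuleExt.add (ModuleExt.add a b) c = ModuleExt.add a (ModuleExt.add b c)
    cases a <;> cases b <;> cases c <;> simp [ModuleExt.add, add_assoc]
  zero_add a := by
    change ModuleExt.add zero a = a
    cases a <;> rfl
  add_zero a := by
    change ModuleExt.add a zero = a
    cases a <;> rfl
  add_comm a b := by
    change ModuleExt.add a b = ModuleExt.add b a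
    cases a <;> cases b <;> simp [ModuleExt.add, add_comm]

instance : Module (RingExt R) (ModuleExt N) where
  smul := ModuleExt.smul
  one_smul a := by
    change ModuleExt.smul (RingExt.ofRing (1 : R)) a = a
    cases a <;> simp [ModuleExt.smul]
  mul_smul s t a := by
    change ModuleExt.smul (RingExt.mul s t) a = ModuleExt.smul s (ModuleExt.smul t a)
    cases s <;> cases t <;> cases a <;> simp [ModuleExt.smul, RingExt.mul, mul_smul]
  smul_zero s := by
    change ModuleExt.smul s zero = zero
    cases s <;> rfl
  zero_smul a := by
    change ModuleExt.smul RingExt.zero a = zero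
    cases a <;> rfl
  smul_add s a b := by
    change ModuleExt.smul s (ModuleExt.add a b) =
      ModuleExt.add (ModuleExt.smul s a) (ModuleExt.smul s b)
    cases s <;> cases a <;> cases b <;> simp [ModuleExt.smul, ModuleExt.add]
  add_smul s t a := by
    change ModuleExt.smul (RingExt.add s t) a =
      ModuleExt.add (ModuleExt.smul s a) (ModuleExt.smul t a)
    cases s <;> cases t <;> cases a <;>
      simp [ModuleExt.smul, ModuleExt.add, RingExt.add, add_smul]

@[simp] theorem of_add_of (m n : N) : of m + of n = of (m + n) := rfl
@[simp] theorem infty_add (x : ModuleExt N) : infty + x = infty := by cases x <;> rfl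
@[simp] theorem add_infty (x : ModuleExt N) : x + infty = infty := by cases x <;> rfl
@[simp] theorem ofRing_smul_of (r : R) (n : N) : RingExt.ofRing r • of n = of (r • n) := rfl
@[simp] theorem ofRing_smul_infty (r : R) :
    RingExt.ofRing r • (infty : ModuleExt N) = infty := rfl
@[simp] theorem infty_smul_of (n : N) : (RingExt.infty : RingExt R) • of n = infty := rfl
@[simp] theorem infty_smul_infty :
    (RingExt.infty : RingExt R) • (infty : ModuleExt N) = infty := rfl

/-- The homomorphism `N ∪ {0, ∞} → N' ∪ {0, ∞}` induced by a homomorphism `N → N'`. -/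
def map (f : N →ₗ[R] N') : ModuleExt N →ₗ[RingExt R] ModuleExt N' where
  toFun
    | zero => zero
    | of n => of (f n)
    | infty => infty
  map_add' x y := by
    cases x <;> cases y <;> simp [zero_eq]
  map_smul' s x := by
    cases s <;> cases x <;> first | rfl | exact congrArg of (map_smul f _ _)

@[simp] theorem map_of (f : N →ₗ[R] N') (n : N) : map f (of n) = of (f n) := rfl

theorem map_injective {f : N →ₗ[R] N'} (hf : Function.Injective f) :
    Function.Injective (map f) := by
  rintro (_ | x | _) (_ | y | _) h <;> try first | rfl | cases h
  exact congrArg of (hf (of.inj h))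

end Algebra

end ModuleExt

/-! ### Arithmetic of `Ext(R)`-semimodules -/

section Semimodule

variable {R : Type u} [Ring R] {B : Type u} [AddCommMonoid B] [Module (RingExt R) B]

open RingExt

theorem ofRing_smul_ofRing_smul (r s : R) (x : B) :
    ofRing r • ofRing s • x = ofRing (r * s) • x := (mul_smul (ofRing r) (ofRing s) x).symm

theorem infty_smul_ofRing_smul (r : R) (x : B) :
    (infty : RingExt R) • ofRing r • x = (infty : RingExt R) • x :=
  (mul_smul (infty : RingExt R) (ofRing r) x).symm

theorem ofRing_smul_infty_smul (r : R) (x : B) :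
    ofRing r • (infty : RingExt R) • x = (infty : RingExt R) • x :=
  (mul_smul (ofRing r) (infty : RingExt R) x).symm

theorem infty_smul_infty_smul (x : B) :
    (infty : RingExt R) • (infty : RingExt R) • x = (infty : RingExt R) • x :=
  (mul_smul (infty : RingExt R) (infty : RingExt R) x).symm

theorem ofRing_smul_add_ofRing_smul (r s : R) (x : B) :
    ofRing r • x + ofRing s • x = ofRing (r + s) • x :=
  (add_smul (ofRing r) (ofRing s) x).symm

theorem ofRing_smul_add_infty_smul (r : R) (x : B) :
    ofRing r • x + (infty : RingExt R) • x = (infty : RingExt R) • x :=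
  (add_smul (ofRing r) (infty : RingExt R) x).symm

theorem ofRing_one_smul (x : B) : ofRing (1 : R) • x = x := one_smul (RingExt R) x

theorem add_ofRing_zero_smul (x : B) : x + ofRing (0 : R) • x = x := by
  conv_lhs => rw [← ofRing_one_smul (R := R) x]
  rw [ofRing_smul_ofRing_smul, ofRing_smul_add_ofRing_smul, zero_mul, add_zero, ofRing_one_smul]

theorem add_infty_smul (x : B) : x + (infty : RingExt R) • x = (infty : RingExt R) • x := by
  conv_lhs => rw [← ofRing_one_smul (R := R) x]
  rw [infty_smul_ofRing_smul, ofRing_smul_add_infty_smul]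

/-- The cancellative quotient of an additive submonoid `F` of an `Ext(R)`-semimodule that is stable
under `R` is an `R`-module. The zero of `R` acts on it as zero because `x + 0 • x = x` in `F`; this
also supplies the additive inverses. It is the colimit of the fibres of `F` over the semilattice of
its idempotents. -/
theorem exists_cancellative_quotient (F : AddSubmonoid B)
    (hF : ∀ (r : R), ∀ x ∈ F, ofRing r • x ∈ F) :
    ∃ (L : Type u) (_ : AddCommGroup L) (_ : Module R L) (q : F →+ L),
      (∀ (r : R) (x : F), q ⟨ofRing r • x.1, hF r x.1 x.2⟩ = r • q x) ∧
      ∀ x y, q x = q y ↔ ∃ z, x + z = y + z := by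
  let c : AddCon F :=
    { r := fun x y => ∃ z, x + z = y + z
      iseqv := ⟨fun x => ⟨0, rfl⟩, fun ⟨z, h⟩ => ⟨z, h.symm⟩, fun {x y w} ⟨z, h⟩ ⟨z', h'⟩ =>
        ⟨z + z', by rw [← add_assoc, h, add_right_comm, h', add_right_comm, add_assoc]⟩⟩
      add' := fun {a b a' b'} ⟨z, h⟩ ⟨z', h'⟩ =>
        ⟨z + z', by rw [add_add_add_comm, h, h', add_add_add_comm]⟩ }
  have hc : ∀ x y : F, (x : c.Quotient) = y ↔ ∃ z, x + z = y + z := fun x y => c.eq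
  let act : R → F →+ F := fun r =>
    { toFun := fun x => ⟨ofRing r • x.1, hF r x.1 x.2⟩
      map_zero' := Subtype.ext (smul_zero _)
      map_add' := fun x y => Subtype.ext (smul_add _ _ _) }
  let actQ : R → c.Quotient →+ c.Quotient := fun r => c.lift (c.mk'.comp (act r)) <| by
    rintro x y ⟨z, h⟩
    exact (hc _ _).2 ⟨act r z, by rw [← map_add, h, map_add]⟩
  have actQ_mk : ∀ r (x : F), actQ r (x : c.Quotient) = (act r x : c.Quotient) :=
    fun r x => rfl
  let smulInst : SMul R c.Quotient := ⟨fun r x => actQ r x⟩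
  let modInst : Module R c.Quotient :=
    { smulInst with
      one_smul := fun x => by
        induction x using AddCon.induction_on with | _ x => ?_
        exact congrArg _ (Subtype.ext (ofRing_one_smul x.1))
      mul_smul := fun r s x => by
        induction x using AddCon.induction_on with | _ x => ?_
        exact congrArg _ (Subtype.ext (ofRing_smul_ofRing_smul r s x.1).symm)
      smul_zero := fun r => map_zero (actQ r)
      smul_add := fun r => map_add (actQ r)
      add_smul := fun r s x => by
        induction x using AddCon.induction_on with | _ x => ?_
        exact congrArg _ (Subtype.ext (ofRing_smul_add_ofRing_smul r s x.1).symm)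
      zero_smul := fun x => by
        induction x using AddCon.induction_on with | _ x => ?_
        refine (hc (act 0 x) 0).2 ⟨x, Subtype.ext ?_⟩
        change ofRing (0 : R) • x.1 + x.1 = 0 + x.1
        rw [add_comm, add_ofRing_zero_smul, zero_add] }
  let grp : AddCommGroup c.Quotient := Module.addCommMonoidToAddCommGroup R
  exact ⟨c.Quotient, grp, modInst, c.mk', fun r x => rfl, hc⟩

end Semimodule

/-! ### Injectivity of `N ∪ {0, ∞}` -/

namespace ModuleExt

variable {R N : Type u} [Ring R] [AddCommGroup N] [Module R N]

/-- The retraction of `N ∪ {0, ∞}` onto `N` sending both new elements to the zero of `N`. -/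
def toModule : ModuleExt N → N
  | of n => n
  | _ => 0

@[simp] theorem toModule_zero : (0 : ModuleExt N).toModule = 0 := rfl
@[simp] theorem toModule_of (n : N) : (of n).toModule = n := rfl
@[simp] theorem toModule_infty : (infty : ModuleExt N).toModule = 0 := rfl

theorem toModule_add {x y : ModuleExt N} (hx : x ≠ infty) (hy : y ≠ infty) :
    (x + y).toModule = x.toModule + y.toModule := by
  cases x <;> cases y <;> simp_all [zero_eq]

theorem toModule_ofRing_smul (r : R) (x : ModuleExt N) :
    (RingExt.ofRing r • x).toModule = r • x.toModule := by
  cases x <;> simp [zero_eq]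

theorem add_ne_infty {x y : ModuleExt N} : x + y ≠ infty ↔ x ≠ infty ∧ y ≠ infty := by
  cases x <;> cases y <;> simp [zero_eq]

theorem ofRing_smul_ne_infty {r : R} {x : ModuleExt N} :
    RingExt.ofRing r • x ≠ infty ↔ x ≠ infty := by
  cases x <;> simp [zero_eq]

theorem infty_smul_ne_infty {x : ModuleExt N} :
    (RingExt.infty : RingExt R) • x ≠ infty ↔ x = 0 := by
  cases x <;> simp [zero_eq]

/-- If the `R`-module `N` is injective, then so is the `Ext(R)`-semimodule `N ∪ {0, ∞}`. -/
theorem isInjectiveSemimodule [Module.Injective R N] :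
    IsInjectiveSemimodule (RingExt R) (ModuleExt N) := by
  intro A B _ _ _ _ μ hμ f
  let e : RingExt R := .ofRing 0
  let top : RingExt R := .infty
  have he : ∀ b : B, e • b + e • b = e • b := fun b => by
    rw [ofRing_smul_add_ofRing_smul, add_zero]
  let F : AddSubmonoid B :=
    { carrier := {b | ∃ a, f a ≠ infty ∧ e • b + e • μ a = e • μ a}
      zero_mem' := ⟨0, by rw [map_zero]; exact nofun, by simp⟩
      add_mem' := by
        rintro x y ⟨a, ha, hxa⟩ ⟨b, hb, hyb⟩
        refine ⟨a + b, by rw [map_add]; exact add_ne_infty.2 ⟨ha, hb⟩, ?_⟩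
        rw [map_add, smul_add, smul_add, add_add_add_comm, hxa, hyb] }
  have hF_of_add : ∀ {x y : B}, x + y ∈ F → x ∈ F := by
    rintro x y ⟨a, ha, h⟩
    refine ⟨a, ha, ?_⟩
    rw [← h, smul_add, ← add_assoc, ← add_assoc, he]
  have hF_smul : ∀ (r : R) (x : B), RingExt.ofRing r • x ∈ F ↔ x ∈ F := by
    intro r x
    have : e • RingExt.ofRing r • x = e • x := by
      rw [ofRing_smul_ofRing_smul, zero_mul]
    change (∃ a, f a ≠ infty ∧ e • RingExt.ofRing r • x + _ = _) ↔ _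
    rw [this]
    rfl
  have hF_of_top : ∀ {x : B}, top • x ∈ F → x ∈ F := fun {x} hx =>
    hF_of_add (show x + top • x ∈ F by rwa [add_infty_smul (R := R)])
  -- As `F` is the lower set generated by the `e • μ a` with `f a ≠ ∞`, injectivity of `μ` gives that
  -- it meets the image of `μ` in no more than the `μ a` with `f a ≠ ∞`.
  have hFμ : ∀ {a : A}, μ a ∈ F ↔ f a ≠ infty := by
    refine fun {a} => ⟨?_, fun ha => ⟨a, ha, he _⟩⟩
    rintro ⟨a', ha', h⟩
    rw [← map_smul, ← map_smul, ← map_add] at h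
    have h1 := congrArg f (hμ h)
    rw [map_add, map_smul, map_smul] at h1
    have h2 : e • f a' ≠ infty := ofRing_smul_ne_infty.2 ha'
    rw [← h1] at h2
    exact ofRing_smul_ne_infty.1 (add_ne_infty.1 h2).1
  obtain ⟨L, _, _, q, hq_smul, hq⟩ := exists_cancellative_quotient F
    fun r x hx => (hF_smul r x).2 hx
  -- The image of `A` in the colimit `L`; `f` descends to it by `hwd`.
  let P : Submodule R L :=
    { carrier := {l | ∃ (a : A) (ha : μ a ∈ F), q ⟨μ a, ha⟩ = l}
      zero_mem' := ⟨0, by rw [map_zero]; exact F.zero_mem, by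
        rw [← map_zero q]; congr 1; exact Subtype.ext (map_zero μ)⟩
      add_mem' := by
        rintro _ _ ⟨a, ha, rfl⟩ ⟨b, hb, rfl⟩
        refine ⟨a + b, by rw [map_add]; exact F.add_mem ha hb, ?_⟩
        refine Eq.trans ?_ (map_add q _ _)
        congr 1
        exact Subtype.ext (map_add μ a b)
      smul_mem' := by
        rintro r _ ⟨a, ha, rfl⟩
        refine ⟨RingExt.ofRing r • a, by rw [map_smul]; exact (hF_smul r _).2 ha, ?_⟩
        rw [← hq_smul]
        congr 1
        exact Subtype.ext (map_smul μ _ a) }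
  have hwd : ∀ {a b : A} (ha : μ a ∈ F) (hb : μ b ∈ F), q ⟨μ a, ha⟩ = q ⟨μ b, hb⟩ →
      (f a).toModule = (f b).toModule := by
    intro a b ha hb hab
    obtain ⟨⟨z, c, hc, hz⟩, h⟩ := (hq _ _).1 hab
    have h1 : μ a + z = μ b + z := congrArg Subtype.val h
    -- Adding `-z` replaces the witness `z` by the idempotent `e • z`, which lies below `e • μ c`; so
    -- the witness can be taken in the image of `μ`.
    have key : ∀ x : B, x + e • μ c = x + z + RingExt.ofRing (-1 : R) • z + e • μ c := by
      intro x
      have hzz : z + RingExt.ofRing (-1 : R) • z = e • z := by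
        nth_rw 1 [← ofRing_one_smul (R := R) z]
        rw [ofRing_smul_add_ofRing_smul, add_neg_cancel]
      rw [add_assoc x, hzz, add_assoc, hz]
    have h2 : μ (a + e • c) = μ (b + e • c) := by
      rw [map_add, map_add, map_smul, key, key (μ b), h1]
    have h3 := congrArg (fun x => (f x).toModule) (hμ h2)
    simp only [map_add, map_smul] at h3
    have hec : e • f c ≠ infty := ofRing_smul_ne_infty.2 hc
    rw [toModule_add (hFμ.1 ha) hec, toModule_add (hFμ.1 hb) hec] at h3
    exact add_right_cancel h3
  choose rep hrepF hrep using fun l : P => l.2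
  have hval : ∀ (l : P) {a : A} (ha : μ a ∈ F), q ⟨μ a, ha⟩ = l.1 →
      (f (rep l)).toModule = (f a).toModule := fun l a ha h =>
    hwd (hrepF l) ha ((hrep l).trans h.symm)
  let φ : P →ₗ[R] N :=
    { toFun := fun l => (f (rep l)).toModule
      map_add' := fun l m => by
        have hF' : μ (rep l + rep m) ∈ F := by
          rw [map_add]; exact F.add_mem (hrepF l) (hrepF m)
        rw [hval (l + m) hF', map_add, toModule_add (hFμ.1 (hrepF l)) (hFμ.1 (hrepF m))]
        refine Eq.trans ?_ (congrArg₂ (· + ·) (hrep l) (hrep m))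
        refine Eq.trans ?_ (map_add q _ _)
        congr 1
        exact Subtype.ext (map_add μ _ _)
      map_smul' := fun r l => by
        have hF' : μ (RingExt.ofRing r • rep l) ∈ F := by
          rw [map_smul]; exact (hF_smul r _).2 (hrepF l)
        rw [hval (r • l) hF', map_smul, toModule_ofRing_smul, RingHom.id_apply]
        refine Eq.trans ?_ (congrArg (r • ·) (hrep l))
        rw [← hq_smul]
        congr 1
        exact Subtype.ext (map_smul μ _ _) }
  obtain ⟨h, hh⟩ := Module.Injective.out P.subtype P.injective_subtype φ
  have hhf : ∀ {a : A} (ha : μ a ∈ F), h (q ⟨μ a, ha⟩) = (f a).toModule := fun {a} ha =>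
    (hh ⟨_, a, ha, rfl⟩).trans (hval _ ha rfl)
  -- `∞ • x` absorbs `x`, so elements on which the extension has to vanish are zero in `L`.
  have hq_zero : ∀ {x : B} (hx : x ∈ F), top • x ∈ F → q ⟨x, hx⟩ = 0 := by
    intro x hx hx'
    rw [← map_zero q, hq]
    refine ⟨⟨top • x, hx'⟩, Subtype.ext ?_⟩
    change x + top • x = 0 + top • x
    rw [add_infty_smul, zero_add]
  classical
  -- Where `∞ • b ∈ F`, the value at `b` has to be `0`: some `f a ≠ ∞` bounds `∞ • g b`.
  let g : B → ModuleExt N := fun b =>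
    if top • b ∈ F then 0 else if hb : b ∈ F then of (h (q ⟨b, hb⟩)) else infty
  have g_zero : ∀ {b}, top • b ∈ F → g b = 0 := fun hb => if_pos hb
  have g_of : ∀ {b} (hb : b ∈ F), top • b ∉ F → g b = of (h (q ⟨b, hb⟩)) := fun hb hb' => by
    simp only [g, if_neg hb', dif_pos hb]
  have g_infty : ∀ {b}, b ∉ F → g b = infty := fun {b} hb => by
    have hb' : top • b ∉ F := fun h => hb (hF_of_top h)
    simp only [g, if_neg hb', dif_neg hb]
  have g_add : ∀ x y, g (x + y) = g x + g y := by
    intro x y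
    by_cases hx : x ∈ F
    swap
    · rw [g_infty hx, g_infty fun h => hx (hF_of_add h), infty_add]
    by_cases hy : y ∈ F
    swap
    · rw [g_infty hy, g_infty fun h => hy (hF_of_add (add_comm x y ▸ h)), add_infty]
    have hq_add : q ⟨x + y, F.add_mem hx hy⟩ = q ⟨x, hx⟩ + q ⟨y, hy⟩ := map_add q ⟨x, hx⟩ ⟨y, hy⟩
    have htop : top • (x + y) ∈ F ↔ top • x ∈ F ∧ top • y ∈ F := by
      rw [smul_add]
      exact ⟨fun h => ⟨hF_of_add h, hF_of_add (add_comm (top • x) _ ▸ h)⟩,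
        fun h => F.add_mem h.1 h.2⟩
    by_cases hx' : top • x ∈ F <;> by_cases hy' : top • y ∈ F
    · rw [g_zero hx', g_zero hy', g_zero (htop.2 ⟨hx', hy'⟩), add_zero]
    · rw [g_zero hx', g_of hy hy', g_of (F.add_mem hx hy) (fun h => hy' (htop.1 h).2), hq_add,
        hq_zero hx hx', zero_add, zero_add]
    · rw [g_of hx hx', g_zero hy', g_of (F.add_mem hx hy) (fun h => hx' (htop.1 h).1), hq_add,
        hq_zero hy hy', add_zero, add_zero]
    · rw [g_of hx hx', g_of hy hy', g_of (F.add_mem hx hy) (fun h => hx' (htop.1 h).1), hq_add,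
        of_add_of, map_add]
  have g_smul : ∀ (s : RingExt R) (x : B), g (s • x) = s • g x := by
    rintro (_ | r | _) x
    · change g ((0 : RingExt R) • x) = (0 : RingExt R) • g x
      rw [zero_smul, zero_smul, g_zero (by rw [smul_zero]; exact F.zero_mem)]
    · have htop : top • RingExt.ofRing r • x = top • x := infty_smul_ofRing_smul r x
      by_cases hx : x ∈ F
      · by_cases hx' : top • x ∈ F
        · rw [g_zero hx', g_zero (htop ▸ hx'), smul_zero]
        · rw [g_of hx hx', g_of ((hF_smul r x).2 hx) (htop ▸ hx'), ofRing_smul_of, ← map_smul,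
            ← hq_smul]
      · rw [g_infty hx, g_infty (fun h => hx ((hF_smul r x).1 h)), ofRing_smul_infty]
    · change g (top • x) = top • g x
      by_cases hx' : top • x ∈ F
      · rw [g_zero hx', smul_zero, g_zero (by rwa [infty_smul_infty_smul])]
      · rw [g_infty hx']
        by_cases hx : x ∈ F
        · rw [g_of hx hx']
          rfl
        · rw [g_infty hx]
          rfl
  refine ⟨⟨⟨g, g_add⟩, g_smul⟩, LinearMap.ext fun a => ?_⟩
  change g (μ a) = f a
  have htop : top • μ a ∈ F ↔ f a = 0 := by
    rw [← map_smul, hFμ, map_smul, infty_smul_ne_infty]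
  by_cases ha : μ a ∈ F
  · by_cases ha' : f a = 0
    · rw [g_zero (htop.2 ha'), ha']
    · rw [g_of ha (fun h => ha' (htop.1 h)), hhf ha]
      have hne := hFμ.1 ha
      cases hfa : f a with
      | zero => exact absurd hfa ha'
      | of n => rfl
      | infty => exact absurd hfa hne
  · rw [g_infty ha]
    by_contra hne
    exact ha (hFμ.2 (Ne.symm hne))

end ModuleExt

/-! ### Cyclic semimodules -/

theorem RingExt.zero_def {R : Type u} : (RingExt.zero : RingExt R) = 0 := rfl

section Cyclic

theorem IsInjectiveSemimodule.of_retract {S : Type u} [Semiring S] {M Q : Type u} [AddCommMonoid M]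
    [Module S M] [AddCommMonoid Q] [Module S Q] (hQ : IsInjectiveSemimodule S Q)
    (i : M →ₗ[S] Q) (p : Q →ₗ[S] M) (hpi : ∀ x, p (i x) = x) : IsInjectiveSemimodule S M := by
  intro A B _ _ _ _ μ hμ f
  obtain ⟨g, hg⟩ := hQ A B μ hμ (i ∘ₗ f)
  refine ⟨p ∘ₗ g, LinearMap.ext fun a => ?_⟩
  have h := LinearMap.congr_fun hg a
  change p (g (μ a)) = f a
  rw [← hpi (f a)]
  exact congrArg p h

variable {R : Type u} [Ring R] {M : Type u} [AddCommMonoid M] [Module (RingExt R) M]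

theorem RingExt.smul_cases {m : M} (hm : ∀ x, ∃ s : RingExt R, s • m = x) (x : M) :
    x = 0 ∨ (∃ r : R, x = RingExt.ofRing r • m) ∨ x = (RingExt.infty : RingExt R) • m := by
  obtain ⟨_ | r | _, rfl⟩ := hm x
  · exact Or.inl (zero_smul (RingExt R) m)
  · exact Or.inr (Or.inl ⟨r, rfl⟩)
  · exact Or.inr (Or.inr rfl)

open RingExt ModuleExt in
/-- If `e` and `∞` act equally on the generator, the semimodule is `{0, ∞ m}`, a retract of
`{e, 0, ∞}`. -/
theorem isInjectiveSemimodule_of_ofRing_zero_smul_eq {m : M}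
    (hm : ∀ x, ∃ s : RingExt R, s • m = x)
    (he : ofRing (0 : R) • m = (RingExt.infty : RingExt R) • m) :
    IsInjectiveSemimodule (RingExt R) M := by
  classical
  set w := (RingExt.infty : RingExt R) • m with hw
  have hr : ∀ r : R, ofRing r • m = w := fun r => by
    rw [← add_zero r, ← ofRing_smul_add_ofRing_smul, he, ofRing_smul_add_infty_smul]
  have hcases : ∀ x : M, x = 0 ∨ x = w := fun x => by
    obtain h | ⟨r, rfl⟩ | h := smul_cases hm x
    exacts [Or.inl h, Or.inr (hr r), Or.inr h]
  have hrw : ∀ r : R, ofRing r • w = w := fun r => ofRing_smul_infty_smul r m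
  have hww : (RingExt.infty : RingExt R) • w = w := infty_smul_infty_smul m
  have hwadd : w + w = w := by
    nth_rw 1 [← he]
    exact ofRing_smul_add_infty_smul 0 m
  have : Module.Injective R PUnit.{u + 1} := ⟨fun _ _ _ _ _ _ _ _ _ => ⟨0, fun _ => rfl⟩⟩
  refine IsInjectiveSemimodule.of_retract (Q := ModuleExt PUnit.{u + 1})
    (ModuleExt.isInjectiveSemimodule (R := R))
    { toFun := fun x => if x = 0 then 0 else ModuleExt.infty
      map_add' := fun x y => ?_
      map_smul' := fun s x => ?_ }
    { toFun := fun x => if x = 0 then 0 else w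
      map_add' := fun x y => ?_
      map_smul' := fun s x => ?_ } fun x => ?_
  · by_cases hw0 : w = 0 <;> obtain rfl | rfl := hcases x <;> obtain rfl | rfl := hcases y <;>
      simp [hw0, hwadd]
  · by_cases hw0 : w = 0 <;> obtain rfl | rfl := hcases x <;> obtain _ | r | _ := s <;>
      simp [hw0, hrw, hww, zero_def]
  · cases x <;> cases y <;> simp [zero_eq, hwadd]
  · cases x <;> obtain _ | r | _ := s <;> simp [zero_eq, zero_def, hrw, hww]
  · obtain rfl | rfl := hcases x <;> by_cases hw0 : w = 0 <;> simp [hw0]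

open RingExt ModuleExt in
/-- If `e` and `∞` act differently on the generator `m`, the semimodule is `(R ⧸ J) ∪ {0, ∞}`, where
`J` consists of the `r` with `r m = e m`. -/
theorem isInjectiveSemimodule_of_ofRing_zero_smul_ne {m : M}
    (hm : ∀ x, ∃ s : RingExt R, s • m = x)
    (he : ofRing (0 : R) • m ≠ (RingExt.infty : RingExt R) • m)
    (hR : ∀ J : Submodule R R, Module.Injective R (R ⧸ J)) :
    IsInjectiveSemimodule (RingExt R) M := by
  let J : Submodule R R :=
    { carrier := {r | ofRing r • m = ofRing (0 : R) • m}
      zero_mem' := rfl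
      add_mem' := fun {r s} hr hs => by
        change _ = _ at hr hs ⊢
        rw [← ofRing_smul_add_ofRing_smul, hr, hs, ofRing_smul_add_ofRing_smul, add_zero]
      smul_mem' := fun r s hs => by
        change _ = _ at hs ⊢
        rw [smul_eq_mul, ← ofRing_smul_ofRing_smul, hs, ofRing_smul_ofRing_smul, mul_zero] }
  have hJ : ∀ r s : R, ofRing r • m = ofRing s • m ↔ r - s ∈ J := by
    intro r s
    change _ ↔ ofRing (r - s) • m = ofRing (0 : R) • m
    rw [sub_eq_add_neg, ← ofRing_smul_add_ofRing_smul]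
    constructor
    · intro h
      rw [h, ofRing_smul_add_ofRing_smul, add_neg_cancel]
    · intro h
      have := congrArg (· + ofRing s • m) h
      simpa only [ofRing_smul_add_ofRing_smul, neg_add_cancel_right, zero_add] using this
  let t : R ⧸ J → M := Quotient.lift (fun r : R => ofRing r • m) fun r s h =>
    (hJ r s).2 ((Submodule.quotientRel_def J).1 h)
  have t_mk : ∀ r, t (Submodule.Quotient.mk r) = ofRing r • m := fun r => rfl
  have t_add : ∀ a b, t (a + b) = t a + t b := by
    intro a b
    obtain ⟨r, rfl⟩ := Submodule.Quotient.mk_surjective J a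
    obtain ⟨s, rfl⟩ := Submodule.Quotient.mk_surjective J b
    rw [← Submodule.Quotient.mk_add, t_mk, t_mk, t_mk, ofRing_smul_add_ofRing_smul]
  have t_smul : ∀ (r : R) a, t (r • a) = ofRing r • t a := by
    intro r a
    obtain ⟨s, rfl⟩ := Submodule.Quotient.mk_surjective J a
    rw [← Submodule.Quotient.mk_smul, t_mk, t_mk, ofRing_smul_ofRing_smul, smul_eq_mul]
  have t_inj : Function.Injective t := by
    intro a b h
    obtain ⟨r, rfl⟩ := Submodule.Quotient.mk_surjective J a
    obtain ⟨s, rfl⟩ := Submodule.Quotient.mk_surjective J b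
    exact (Submodule.Quotient.eq J).2 ((hJ r s).1 h)
  have infty_smul_t : ∀ a, (RingExt.infty : RingExt R) • t a = (RingExt.infty : RingExt R) • m := by
    intro a
    obtain ⟨s, rfl⟩ := Submodule.Quotient.mk_surjective J a
    exact infty_smul_ofRing_smul s m
  have t_add_infty : ∀ a, t a + (RingExt.infty : RingExt R) • m = (RingExt.infty : RingExt R) • m := by
    intro a
    rw [← infty_smul_t a, add_infty_smul]
  have infty_add_t : ∀ a, (RingExt.infty : RingExt R) • m + t a = (RingExt.infty : RingExt R) • m :=
    fun a => (add_comm _ _).trans (t_add_infty a)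
  have infty_add_infty : (RingExt.infty : RingExt R) • m + (RingExt.infty : RingExt R) • m =
      (RingExt.infty : RingExt R) • m := by
    nth_rw 2 [← infty_smul_infty_smul]
    rw [add_infty_smul, infty_smul_infty_smul]
  have zero_smul_t : ∀ a, ofRing (0 : R) • t a = ofRing (0 : R) • m := fun a => by
    rw [← t_smul, zero_smul]
    rfl
  have infty_ne : (RingExt.infty : RingExt R) • m ≠ 0 := fun h => he <| by
    have h1 := ofRing_smul_add_infty_smul (0 : R) m
    rw [h, add_zero] at h1
    rw [h1, h]
  have t_ne_infty : ∀ a, t a ≠ (RingExt.infty : RingExt R) • m := fun a h => he <| by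
    rw [← zero_smul_t a, h, ofRing_smul_infty_smul]
  have t_ne_zero : ∀ a, t a ≠ 0 := fun a h => infty_ne <| by
    rw [← infty_smul_t a, h, smul_zero]
  let p : ModuleExt (R ⧸ J) →ₗ[RingExt R] M :=
    { toFun
        | .zero => 0
        | .of n => t n
        | .infty => (RingExt.infty : RingExt R) • m
      map_add' := fun x y => by
        cases x <;> cases y <;>
          simp [zero_eq, t_add, t_add_infty, infty_add_t, infty_add_infty]
      map_smul' := fun s x => by
        obtain _ | r | _ := s <;> cases x <;>
          simp [zero_eq, zero_def, t_smul, infty_smul_t, ofRing_smul_infty_smul,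
            infty_smul_infty_smul] }
  have hp : Function.Bijective p := by
    constructor
    · rintro (_ | a | _) (_ | b | _) h
      · rfl
      · exact absurd h.symm (t_ne_zero b)
      · exact absurd h.symm infty_ne
      · exact absurd h (t_ne_zero a)
      · rw [t_inj h]
      · exact absurd h (t_ne_infty a)
      · exact absurd h infty_ne
      · exact absurd h.symm (t_ne_infty b)
      · rfl
    · intro x
      obtain rfl | ⟨r, rfl⟩ | rfl := smul_cases hm x
      exacts [⟨.zero, rfl⟩, ⟨.of (Submodule.Quotient.mk r), rfl⟩, ⟨.infty, rfl⟩]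
  have := hR J
  let E := LinearEquiv.ofBijective p hp
  exact (ModuleExt.isInjectiveSemimodule (R := R) (N := R ⧸ J)).of_retract E.symm.toLinearMap
    E.toLinearMap E.apply_symm_apply

end Cyclic

/-! ### CI-semirings -/

/-- Every left `S`-semimodule generated by a single element is injective. This describes left
CI-semirings, and right ones after passing to `Sᵐᵒᵖ`. -/
def AllCyclicInjective (S : Type u) [Semiring S] : Prop :=
  ∀ (M : Type u) [AddCommMonoid M] [Module S M],
    (∃ m : M, ∀ x, ∃ s : S, s • m = x) → IsInjectiveSemimodule S M

theorem isLeftCISemiring_iff (S : Type u) [Semiring S] :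
    IsLeftCISemiring S ↔ AllCyclicInjective S := by
  refine ⟨fun h M _ _ ⟨m, hm⟩ => h M ⟨LinearMap.toSpanSingleton S M m, hm⟩,
    fun h M _ _ ⟨p, hp⟩ => h M ⟨p 1, fun x => ?_⟩⟩
  obtain ⟨s, rfl⟩ := hp x
  exact ⟨s, by rw [← map_smul, smul_eq_mul, mul_one]⟩

open MulOpposite in
theorem isRightCISemiring_iff (S : Type u) [Semiring S] :
    IsRightCISemiring S ↔ AllCyclicInjective Sᵐᵒᵖ := by
  refine ⟨fun h M _ _ ⟨m, hm⟩ => h M ⟨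
    { toFun := fun s => op s • m
      map_add' := fun s t => add_smul (op s) (op t) m
      map_smul' := fun s t => mul_smul s (op t) m }, fun x => ?_⟩,
    fun h M _ _ ⟨p, hp⟩ => h M ⟨p 1, fun x => ?_⟩⟩
  · obtain ⟨s, rfl⟩ := hm x
    exact ⟨unop s, rfl⟩
  · obtain ⟨s, rfl⟩ := hp x
    exact ⟨op s, by rw [← map_smul, op_smul_eq_mul, one_mul]⟩

theorem AllCyclicInjective.of_ringEquiv {S T : Type u} [Semiring S] [Semiring T] (σ : S ≃+* T)
    (hS : AllCyclicInjective S) : AllCyclicInjective T := by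
  intro M _ _ ⟨m, hm⟩ A B _ _ _ _ μ hμ f
  let _ : Module S M := Module.compHom M (σ : S →+* T)
  let _ : Module S A := Module.compHom A (σ : S →+* T)
  let _ : Module S B := Module.compHom B (σ : S →+* T)
  have hcyc : ∃ m : M, ∀ x, ∃ s : S, s • m = x := ⟨m, fun x => by
    obtain ⟨t, rfl⟩ := hm x
    exact ⟨σ.symm t, congrArg (· • m) (σ.apply_symm_apply t)⟩⟩
  let μ' : A →ₗ[S] B := ⟨⟨μ, map_add μ⟩, fun s => map_smul μ (σ s)⟩
  let f' : A →ₗ[S] M := ⟨⟨f, map_add f⟩, fun s => map_smul f (σ s)⟩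
  obtain ⟨g, hg⟩ := hS M hcyc A B μ' hμ f'
  refine ⟨⟨⟨g, map_add g⟩, fun t b => ?_⟩, LinearMap.ext fun a => LinearMap.congr_fun hg a⟩
  obtain ⟨s, rfl⟩ := σ.surjective t
  exact map_smul g s b

/-- The opposite semiring of `Ext(R)` is `Ext` of the opposite ring. -/
def ringExtOpEquiv (R : Type u) [Ring R] : RingExt Rᵐᵒᵖ ≃+* (RingExt R)ᵐᵒᵖ where
  toFun
    | .zero => .op .zero
    | .ofRing r => .op (.ofRing r.unop)
    | .infty => .op .infty
  invFun x := match x.unop with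
    | .zero => .zero
    | .ofRing r => .ofRing (.op r)
    | .infty => .infty
  left_inv x := by cases x <;> rfl
  right_inv x := by
    induction x using MulOpposite.rec' with | _ x => ?_
    cases x <;> rfl
  map_mul' x y := by cases x <;> cases y <;> rfl
  map_add' x y := by cases x <;> cases y <;> rfl

theorem allCyclicInjective_of_isSemisimpleRing (R : Type u) [Ring R] [IsSemisimpleRing R] :
    AllCyclicInjective (RingExt R) := by
  rintro M _ _ ⟨m, hm⟩
  by_cases he : RingExt.ofRing (0 : R) • m = (RingExt.infty : RingExt R) • m
  · exact isInjectiveSemimodule_of_ofRing_zero_smul_eq hm he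
  · exact isInjectiveSemimodule_of_ofRing_zero_smul_ne hm he
      fun J => Module.injective_of_isSemisimpleRing R _

/-- An extension problem `I ≤ R`, `I → R ⧸ J` of `R`-modules is solved by adjoining `0` and `∞`
throughout. -/
theorem baer_of_allCyclicInjective {R : Type u} [Ring R] (H : AllCyclicInjective (RingExt R))
    (J : Submodule R R) : Module.Baer R (R ⧸ J) := by
  intro I f
  have hcyc : ∃ m : ModuleExt (R ⧸ J), ∀ x, ∃ s : RingExt R, s • m = x := by
    refine ⟨.of (Submodule.Quotient.mk 1), ?_⟩
    rintro (_ | n | _)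
    · exact ⟨0, zero_smul _ _⟩
    · obtain ⟨r, rfl⟩ := Submodule.Quotient.mk_surjective J n
      refine ⟨.ofRing r, ?_⟩
      rw [ModuleExt.ofRing_smul_of, ← Submodule.Quotient.mk_smul, smul_eq_mul, mul_one]
    · exact ⟨.infty, rfl⟩
  obtain ⟨g, hg⟩ := H _ hcyc _ _ (ModuleExt.map I.subtype)
    (ModuleExt.map_injective I.injective_subtype) (ModuleExt.map f)
  have hg' : ∀ x, g (ModuleExt.map I.subtype x) = ModuleExt.map f x := LinearMap.congr_fun hg
  have h0 : g (.of 0) = .of 0 := by simpa using hg' (.of 0)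
  -- An element `r` of `R` has `e • r = e`, so its image lies in the fibre over the zero of `R ⧸ J`.
  have hex : ∀ r : R, ∃ n, g (.of r) = .of n := by
    intro r
    have h1 : RingExt.ofRing (0 : R) • g (.of r) = .of 0 := by
      rw [← map_smul, ModuleExt.ofRing_smul_of, zero_smul, h0]
    cases h2 : g (.of r) with
    | zero => rw [h2] at h1; cases h1
    | of n => exact ⟨n, rfl⟩
    | infty => rw [h2] at h1; cases h1
  choose φ hφ using hex
  refine ⟨⟨⟨φ, fun r s => ?_⟩, fun r s => ?_⟩, fun x hx => ?_⟩ <;> apply ModuleExt.of.inj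
  · rw [← hφ, ← ModuleExt.of_add_of, map_add, hφ, hφ, ModuleExt.of_add_of]
  · rw [← hφ, ← ModuleExt.ofRing_smul_of, map_smul, hφ]
    rfl
  · exact (hφ x).symm.trans (hg' (.of ⟨x, hx⟩))

theorem allCyclicInjective_ringExt_iff (R : Type u) [Ring R] :
    AllCyclicInjective (RingExt R) ↔ IsSemisimpleRing R :=
  ⟨fun H => isSemisimpleRing_of_forall_baer (baer_of_allCyclicInjective H),
    fun _ => allCyclicInjective_of_isSemisimpleRing R⟩

theorem theorem4p18 (R : Type u) [Ring R] :
    (IsLeftCISemiring (RingExt R) ↔ IsSemisimpleRing R) ∧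
      (IsRightCISemiring (RingExt R) ↔ IsSemisimpleRing R) := by
  refine ⟨(isLeftCISemiring_iff _).trans (allCyclicInjective_ringExt_iff R), ?_⟩
  rw [isRightCISemiring_iff, ← isSemisimpleRing_mulOpposite_iff, ← allCyclicInjective_ringExt_iff]
  exact ⟨.of_ringEquiv (ringExtOpEquiv R).symm, .of_ringEquiv (ringExtOpEquiv R)⟩
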